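/- Let $d\ge 2$, $\alpha\in(0,2]$, $\beta\in(0,1)$. There is a constant $c=c(d,\alpha,\beta)>0$ with the following property. Let $D\subset\mathbb R^d$ be a domain (a non-empty open connected set) such that $|D^c\cap B_r(z)|\ge \beta\,|B_r(z)|$ for every $z\in\partial D$ and every $r>0$. Let $V$ be a bounded (measurable) real function on $D$, and let $u:\mathbb R^d\to\mathbb R$ be a bounded continuous function, not identically zero in $D$, that solves $$-(-\Delta)^{\alpha/2}u+Vu=0\quad\text{in } D,\qquad u=0\quad\text{in } D^c$$ in the sense of distributions, where for $\alpha=2$ the operator is $\Delta$ and the boundary condition is read as $u=0$ on $\partial D$. Let $X$ be the spherically symmetric $\alpha$-stable process in $\mathbb R^d$, that is, the Lévy process with càdlàg paths and $\mathbb E[e^{i\xi\cdot(X_t-X_0)}]=e^{-t|\xi|^\alpha}$ (for $\alpha=2$: Brownian motion, with continuous paths, run at twice the standard speed), write $\mathbb E_x$ for the expectation when $X_0=x$, and put $\tau=\inf\{t>0: X_t\notin D\}$. Assume that $u$ has the Feynman–Kac representation $$\textbf{(H)}\qquad u(x)=\mathbb E_x\Bigl[e^{\int_0^{t\wedge\tau}V(X_s)\,ds}\,u(X_{t\wedge\tau})\Bigr]\qquad\text{for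 all } x\in D,\ t>0 .$$ If $x_0\in D$ and $|u(x_0)|=\max_{D}|u|$, then $$\operatorname{dist}(x_0,\partial D)\ \ge\ c\,\Bigl(\sup_{x\in D}|V(x)|\Bigr)^{-1/\alpha},$$ with the conventions $0^{-1/\alpha}=\infty$ and $\operatorname{dist}(x_0,\emptyset)=\infty$. -/

import Mathlib

open MeasureTheory ProbabilityTheory Filter Set
open scoped NNReal ENNReal Topology

namespace FracSchrodinger

/-- `X` is, under `P`, the spherically symmetric `α`-stable process in `ℝᵈ` started at `0`:
the Lévy process with `E[exp (i ξ · (X_{s+t} - X_s))] = exp (-t |ξ|^α)`. For `α = 2` this is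
Brownian motion run at twice the standard speed, with continuous paths.
The process started at `x` is `x + X`. -/
structure IsStableProcess {d : ℕ} {Ω : Type*} [MeasurableSpace Ω] (P : Measure Ω) (α : ℝ)
    (X : ℝ≥0 → Ω → EuclideanSpace ℝ (Fin d)) : Prop where
  measurable : ∀ t, Measurable (X t)
  start : ∀ᵐ ω ∂P, X 0 ω = 0
  indep : HasIndepIncrements X P
  charFun_increment : ∀ (s t : ℝ≥0) (ξ : EuclideanSpace ℝ (Fin d)),
    charFun (P.map (fun ω => X (s + t) ω - X s ω)) ξ
      = ((Real.exp (-(t : ℝ) * ‖ξ‖ ^ α) : ℝ) : ℂ)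
  cadlag : ∀ᵐ ω ∂P, ∀ t : ℝ≥0, ContinuousWithinAt (fun s => X s ω) (Ici t) t ∧
    ∃ l, Tendsto (fun s => X s ω) (𝓝[<] t) (𝓝 l)
  continuous : α = 2 → ∀ᵐ ω ∂P, Continuous (fun s => X s ω)

/-- The first exit time `inf {t > 0 : γ t ∉ A}` of a path `γ` from `A`; it is `∞` if the path
stays in `A` at all positive times. -/
noncomputable def exitTime {E : Type*} (γ : ℝ≥0 → E) (A : Set E) : ℝ≥0∞ :=
  ⨅ (t : ℝ≥0) (_ : 0 < t ∧ γ t ∉ A), (t : ℝ≥0∞)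

/-- The time `t ∧ τ(A)` along the path `γ`. -/
noncomputable def stoppedTime {E : Type*} (γ : ℝ≥0 → E) (A : Set E) (t : ℝ≥0) : ℝ≥0 :=
  (min (t : ℝ≥0∞) (exitTime γ A)).toNNReal

/-- The normalizing constant `c_{d,α} = 2^α Γ((d+α)/2) / (π^{d/2} |Γ(-α/2)|)`, for which the
fractional Laplacian has Fourier symbol `|ξ|^α`. -/
noncomputable def stableConst (d : ℕ) (α : ℝ) : ℝ :=
  2 ^ α * Real.Gamma ((d + α) / 2) / (Real.pi ^ ((d : ℝ) / 2) * |Real.Gamma (-α / 2)|)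

/-- The operator `-(-Δ)^{α/2}` acting on a smooth function `φ` (used on test functions). -/
noncomputable def stableGenerator {d : ℕ} (α : ℝ) (φ : EuclideanSpace ℝ (Fin d) → ℝ)
    (x : EuclideanSpace ℝ (Fin d)) : ℝ :=
  if α = 2 then Laplacian.laplacian φ x
  else stableConst d α *
    ∫ y, (φ (x + y) - φ x - (Metric.closedBall 0 1).indicator (fun y => fderiv ℝ φ x y) y)
      / ‖y‖ ^ ((d : ℝ) + α)

/-- `u ∈ C_b(ℝᵈ)` solves `-(-Δ)^{α/2} u + V u = 0` in `D` in the sense of distributions, and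
`u = 0` off `D` if `α < 2`, `u = 0` on `∂D` if `α = 2`. -/
structure IsSolution {d : ℕ} (α : ℝ) (D : Set (EuclideanSpace ℝ (Fin d)))
    (V : EuclideanSpace ℝ (Fin d) → ℝ)
    (u : BoundedContinuousFunction (EuclideanSpace ℝ (Fin d)) ℝ) : Prop where
  equation : ∀ φ : EuclideanSpace ℝ (Fin d) → ℝ,
    ContDiff ℝ ((⊤ : ℕ∞) : WithTop ℕ∞) φ → HasCompactSupport φ → tsupport φ ⊆ D →
      (∫ x, u x * stableGenerator α φ x) + ∫ x in D, V x * u x * φ x = 0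
  boundary : ∀ x ∈ (if α = 2 then frontier D else Dᶜ), u x = 0

/-- The Feynman-Kac representation of `u` in `D`:
`u(x) = E_x[exp (∫_0^{t ∧ τ(D)} V(X_s) ds) u(X_{t ∧ τ(D)})]` for all `x ∈ D` and `t > 0`.
Only the values of `V` on `D` matter, as the path is in `D` at all times in `(0, τ(D))`. -/
def HasFeynmanKac {d : ℕ} {Ω : Type*} [MeasurableSpace Ω] (P : Measure Ω)
    (X : ℝ≥0 → Ω → EuclideanSpace ℝ (Fin d)) (D : Set (EuclideanSpace ℝ (Fin d)))
    (V u : EuclideanSpace ℝ (Fin d) → ℝ) : Prop :=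
  ∀ x ∈ D, ∀ t : ℝ≥0, 0 < t →
    u x = ∫ ω, Real.exp (∫ s in (0 : ℝ)..(stoppedTime (fun r => x + X r ω) D t : ℝ),
        V (x + X s.toNNReal ω)) * u (x + X (stoppedTime (fun r => x + X r ω) D t) ω) ∂P

/-- The class of domains (open connected sets) `D` of `ℝᵈ` with
`|Dᶜ ∩ B_r(z)| ≥ β |B_r(z)|` for all `z ∈ ∂D` and `r > 0`. -/
structure IsThickDomain {d : ℕ} (β : ℝ) (D : Set (EuclideanSpace ℝ (Fin d))) : Prop where
  isOpen : IsOpen D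
  isConnected : IsConnected D
  thick : ∀ z ∈ frontier D, ∀ r : ℝ, 0 < r →
    ENNReal.ofReal β * volume (Metric.ball z r) ≤ volume (Dᶜ ∩ Metric.ball z r)

end FracSchrodinger

/-! ### Fourier inversion and a lower bound for the stable law near the origin. -/

section Fourier

open scoped FourierTransform SchwartzMap

/-! At a maximum point `x₀` of `|u|`, paths that leave `D` by time `t` contribute nothing to
Feynman–Kac, and the others gain at most `exp (M t)`, with `M = sup |V|`. Hence `1 ≤ exp (M t) *
P(x₀ + X_t ∈ D)` (`one_le_exp_mul_of_isMaxOn`).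

If `r` is the distance to the boundary and `t` is a suitable multiple of `r ^ α`, thickness of `Dᶜ`
at a nearest boundary point gives `P(x₀ + X_t ∉ D) ≥ η`, with `η` depending only on `d`, `α`, `β`.
So `1 ≤ exp (M t) * (1 - η) ≤ exp (M t - η)`, that is `M t ≥ η`, a lower bound on `r`.

The estimate for `η` needs the law at time 1 to dominate a multiple of Lebesgue measure near 0
(`exists_smul_volume_le_stable`), then scaling (`IsStableProcess.smul_volume_le`). The
characteristic function is integrable with positive integral, so the density is continuous and
positive at 0. -/

theorem exists_contDiff_eq_one_eq_zero {E : Type*} [NormedAddCommGroup E]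
    [NormedSpace ℝ E] [FiniteDimensional ℝ E] {K U : Set E} (hK : IsClosed K) (hU : IsOpen U)
    (hKU : K ⊆ U) :
    ∃ f : E → ℝ, ContDiff ℝ ((⊤ : ℕ∞) : WithTop ℕ∞) f ∧ EqOn f 0 Uᶜ ∧ EqOn f 1 K ∧
      ∀ x, f x ∈ Icc (0 : ℝ) 1 := by
  obtain ⟨f, h0, h1, h2⟩ := exists_contMDiffMap_zero_one_of_isClosed (n := (⊤ : ℕ∞))
    (modelWithCornersSelf ℝ E) hU.isClosed_compl hK
    (disjoint_compl_left_iff_subset.2 hKU)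
  exact ⟨f, f.contMDiff.contDiff, h0, h1, h2⟩

variable {E : Type*} [NormedAddCommGroup E] [InnerProductSpace ℝ E] [FiniteDimensional ℝ E]
  [MeasurableSpace E] [BorelSpace E]

/-- Fourier inversion for measures, tested against Schwartz functions. -/
theorem integral_schwartz_eq_integral_fourierInv_charFun (μ : Measure E) [IsFiniteMeasure μ]
    (hμ : Integrable (fun ξ => charFun μ (-(2 * Real.pi) • ξ))) (φ : 𝓢(E, ℂ)) :
    ∫ x, φ x ∂μ = ∫ x, φ x * 𝓕⁻ (fun ξ => charFun μ (-(2 * Real.pi) • ξ)) x := by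
  have hL : Continuous fun p : E × E => (innerₗ E) p.1 p.2 := continuous_inner
  have hL' : Continuous fun p : E × E => (-innerₗ E) p.1 p.2 := continuous_inner.neg
  have hflip : (innerₗ E).flip = innerₗ E := by
    ext x y; simp
  have hflip' : (-innerₗ E).flip = -innerₗ E := by
    ext x y; simp [real_inner_comm]
  have hchar : ∀ ξ, VectorFourier.fourierIntegral Real.fourierChar μ (innerₗ E) 1 ξ
      = charFun μ (-(2 * Real.pi) • ξ) := by
    intro ξ
    rw [charFun_eq_fourierIntegral', smul_smul]
    congr 1
    have : -(2 * Real.pi)⁻¹ * -(2 * Real.pi) = 1 := by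
      have := Real.pi_pos.ne'
      field_simp
    rw [this, one_smul]
  -- The transform is moved across the pairing twice: between `μ` and Lebesgue measure with `𝓕⁻ φ`,
  -- then back onto `φ`, where `-innerₗ E` gives the inverse transform.
  have h1 := VectorFourier.integral_fourierIntegral_smul_eq_flip (μ := μ)
    (ν := (volume : Measure E)) (L := innerₗ E) (f := (1 : E → ℂ)) (g := ⇑(𝓕⁻ φ : 𝓢(E, ℂ)))
    Real.continuous_fourierChar hL (integrable_const (1 : ℂ)) (𝓕⁻ φ : 𝓢(E, ℂ)).integrable
  have h2 := VectorFourier.integral_fourierIntegral_smul_eq_flip (μ := (volume : Measure E))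
    (ν := (volume : Measure E)) (L := -innerₗ E) (f := ⇑φ)
    (g := fun ξ => charFun μ (-(2 * Real.pi) • ξ))
    Real.continuous_fourierChar hL' φ.integrable hμ
  rw [hflip] at h1
  rw [hflip'] at h2
  have h3 : ∀ x, VectorFourier.fourierIntegral Real.fourierChar volume (innerₗ E)
      (⇑(𝓕⁻ φ : 𝓢(E, ℂ))) x
      = φ x := by
    intro x
    have : (𝓕 (𝓕⁻ φ : 𝓢(E, ℂ))) x = φ x := by rw [FourierTransform.fourier_fourierInv_eq]
    rw [SchwartzMap.fourier_coe] at this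
    exact this
  simp only [hchar, h3, Pi.one_apply, smul_eq_mul, one_mul] at h1
  rw [← h1]
  simp only [smul_eq_mul] at h2
  refine Eq.trans ?_ h2
  congr 1
  ext ξ
  rw [mul_comm, SchwartzMap.fourierInv_coe]
  rfl

theorem continuous_fourierInv {f : E → ℂ} (hf : Integrable f) : Continuous (𝓕⁻ f) :=
  VectorFourier.fourierIntegral_continuous (L := -innerₗ E) Real.continuous_fourierChar
    continuous_inner.neg hf

/-- A family of finite measures with a common integrable characteristic function of positive
integral is bounded below near `0` by a fixed multiple of the Lebesgue measure. -/
theorem exists_smul_volume_le_of_charFun_eq {χ : E → ℂ}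
    (hχ : Integrable fun ξ => χ (-(2 * Real.pi) • ξ))
    (h0 : 0 < (∫ ξ, χ (-(2 * Real.pi) • ξ)).re) :
    ∃ ε > 0, ∃ κ > 0, ∀ (μ : Measure E) [IsFiniteMeasure μ], charFun μ = χ →
      ∀ A ⊆ Metric.ball (0 : E) ε, ENNReal.ofReal κ * volume A ≤ μ A := by
  set p : E → ℂ := 𝓕⁻ (fun ξ => χ (-(2 * Real.pi) • ξ)) with hp
  have hpc : Continuous p := continuous_fourierInv hχ
  have hp0 : p 0 = ∫ ξ, χ (-(2 * Real.pi) • ξ) := by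
    simp [hp, Real.fourierInv_eq]
  set κ := (p 0).re / 2 with hκ
  have hκ0 : 0 < κ := by rw [hκ, hp0]; exact half_pos h0
  have hnear : ∀ᶠ x in 𝓝 (0 : E), κ < (p x).re :=
    (Complex.continuous_re.comp hpc).continuousAt.eventually
      (lt_mem_nhds (by simp only [Function.comp]; linarith))
  obtain ⟨ε, hε, hball⟩ := Metric.eventually_nhds_iff_ball.1 hnear
  refine ⟨ε, hε, κ, hκ0, ?_⟩
  intro μ _ hμ
  -- Open sets come first, by inner regularity and a smooth cutoff between `K` and `U`; outer
  -- regularity of `μ` then reaches every `A`, measurable or not.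
  have hopen : ∀ U : Set E, IsOpen U → U ⊆ Metric.ball (0 : E) ε →
      ENNReal.ofReal κ * volume U ≤ μ U := by
    intro U hU hUb
    rw [hU.measure_eq_iSup_isCompact, ENNReal.mul_iSup]
    refine iSup_le fun K => ?_
    rw [ENNReal.mul_iSup]
    refine iSup_le fun hKU => ?_
    rw [ENNReal.mul_iSup]
    refine iSup_le fun hK => ?_
    obtain ⟨f, hf, hf0, hf1, hf01⟩ := exists_contDiff_eq_one_eq_zero hK.isClosed hU hKU
    have hcs : HasCompactSupport f := by
      refine HasCompactSupport.intro (isCompact_closedBall (0 : E) ε) fun x hx => ?_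
      exact hf0 fun hxU => hx (Metric.ball_subset_closedBall (hUb hxU))
    have hcs' : HasCompactSupport (fun x => (f x : ℂ)) := hcs.comp_left Complex.ofReal_zero
    have key := integral_schwartz_eq_integral_fourierInv_charFun μ (by rwa [hμ])
      (hcs'.toSchwartzMap (Complex.ofRealCLM.contDiff.comp hf))
    rw [hμ] at key
    change ∫ x, (f x : ℂ) ∂μ = ∫ x, (f x : ℂ) * p x at key
    have hfp : Integrable (fun x => (f x : ℂ) * p x) :=
      ((Complex.continuous_ofReal.comp hf.continuous).mul hpc).integrable_of_hasCompactSupport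
        hcs'.mul_right
    have key2 : ∫ x, f x ∂μ = ∫ x, f x * (p x).re := by
      have := congrArg Complex.re key
      rw [integral_complex_ofReal, Complex.ofReal_re] at this
      rw [this]
      have h := integral_re hfp
      simp only [RCLike.re_to_complex, Complex.re_ofReal_mul] at h
      exact h.symm
    have hmeasK : MeasurableSet K := hK.measurableSet
    have hKfin : volume K ≠ ∞ := hK.measure_lt_top.ne
    have hfi : Integrable (fun x => f x * (p x).re) := by
      simpa only [RCLike.re_to_complex, Complex.re_ofReal_mul] using hfp.re
    have hlow : κ * volume.real K ≤ ∫ x, f x * (p x).re := by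
      have h : ∫ x, K.indicator (fun _ => κ) x ≤ ∫ x, f x * (p x).re := by
        refine integral_mono ((integrable_indicator_iff hmeasK).2
          (integrableOn_const hKfin)) hfi fun x => ?_
        by_cases hxK : x ∈ K
        · have : f x = 1 := hf1 hxK
          simp only [indicator_of_mem hxK, this, one_mul]
          exact (hball x (hUb (hKU hxK))).le
        · simp only [indicator_of_notMem hxK]
          by_cases hxU : x ∈ U
          · exact mul_nonneg (hf01 x).1 (hκ0.le.trans (hball x (hUb hxU)).le)
          · have : f x = 0 := hf0 hxU
            simp [this]
      rwa [integral_indicator_const _ hmeasK, smul_eq_mul, mul_comm] at h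
    have hup : ∫ x, f x ∂μ ≤ μ.real U := by
      have h : ∫ x, f x ∂μ ≤ ∫ x, U.indicator (fun _ => (1 : ℝ)) x ∂μ := by
        refine integral_mono (hf.continuous.integrable_of_hasCompactSupport hcs)
          ((integrable_indicator_iff hU.measurableSet).2 (integrableOn_const (measure_ne_top _ _)))
          fun x => ?_
        by_cases hxU : x ∈ U
        · simpa only [indicator_of_mem hxU] using (hf01 x).2
        · have : f x = 0 := hf0 hxU
          simp [this, hxU]
      rwa [integral_indicator_const _ hU.measurableSet, smul_eq_mul, mul_one] at h
    rw [← ofReal_measureReal hKfin, ← ENNReal.ofReal_mul hκ0.le,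
      ← ofReal_measureReal (measure_ne_top μ U)]
    exact ENNReal.ofReal_le_ofReal (hlow.trans (key2 ▸ hup))
  intro A hA
  rw [A.measure_eq_iInf_isOpen μ]
  refine le_iInf fun U => le_iInf fun hAU => le_iInf fun hU => ?_
  calc ENNReal.ofReal κ * volume A
      ≤ ENNReal.ofReal κ * volume (U ∩ Metric.ball 0 ε) := by
        gcongr; exact subset_inter hAU hA
    _ ≤ μ (U ∩ Metric.ball 0 ε) := hopen _ (hU.inter Metric.isOpen_ball) inter_subset_right
    _ ≤ μ U := measure_mono inter_subset_left

theorem integrable_exp_neg_mul_norm_rpow {α b : ℝ} (hα : 0 < α) (hb : 0 < b) [Nontrivial E] :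
    Integrable fun ξ : E => Real.exp (-b * ‖ξ‖ ^ α) := by
  refine (integrable_fun_norm_addHaar (E := E) volume
    (f := fun y : ℝ => Real.exp (-b * y ^ α))).2 ?_
  have := integrableOn_rpow_mul_exp_neg_mul_rpow (p := α)
    (s := ((Module.finrank ℝ E - 1 : ℕ) : ℝ)) (neg_one_lt_zero.trans_le (Nat.cast_nonneg _)) hα hb
  simpa only [Real.rpow_natCast, smul_eq_mul] using this

/-- The standard isotropic stable laws are bounded below near `0` by a multiple of the Lebesgue
measure. -/
theorem exists_smul_volume_le_stable [Nontrivial E] {α : ℝ} (hα : 0 < α) :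
    ∃ ε > 0, ∃ κ > 0, ∀ (μ : Measure E) [IsFiniteMeasure μ],
      (∀ ξ, charFun μ ξ = ((Real.exp (-‖ξ‖ ^ α) : ℝ) : ℂ)) →
      ∀ A ⊆ Metric.ball (0 : E) ε, ENNReal.ofReal κ * volume A ≤ μ A := by
  have hb : 0 < (2 * Real.pi) ^ α := Real.rpow_pos_of_pos (by positivity) _
  have hint := integrable_exp_neg_mul_norm_rpow (E := E) hα hb
  have heq : ∀ ξ : E, -‖-(2 * Real.pi) • ξ‖ ^ α = -(2 * Real.pi) ^ α * ‖ξ‖ ^ α := by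
    intro ξ
    rw [norm_smul, norm_neg, Real.norm_of_nonneg (by positivity),
      Real.mul_rpow (by positivity) (norm_nonneg _), neg_mul]
  obtain ⟨ε, hε, κ, hκ, h⟩ := exists_smul_volume_le_of_charFun_eq
    (χ := fun ξ : E => ((Real.exp (-‖ξ‖ ^ α) : ℝ) : ℂ))
    (by simp only [heq]; exact hint.ofReal)
    (by
      simp only [heq]
      rw [integral_complex_ofReal, Complex.ofReal_re]
      exact integral_exp_pos hint)
  exact ⟨ε, hε, κ, hκ, fun μ _ hμ => h μ (funext hμ)⟩

end Fourier

namespace FracSchrodinger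

/-! ### Exit times and the pathwise Feynman–Kac bound. -/

section ExitTime

variable {F : Type*} {γ : ℝ≥0 → F} {A : Set F}

theorem mem_of_lt_exitTime {t : ℝ≥0} (ht : 0 < t) (h : (t : ℝ≥0∞) < exitTime γ A) : γ t ∈ A := by
  by_contra hA
  have : exitTime γ A ≤ t := iInf₂_le t ⟨ht, hA⟩
  exact this.not_gt h

variable [TopologicalSpace F]

/-- Were the path in the open set at its exit time, right-continuity would keep it there a little
longer, contradicting the infimum. -/
theorem apply_exitTime_notMem (hA : IsOpen A)
    (hγ : ∀ t, ContinuousWithinAt γ (Ici t) t) (hfin : exitTime γ A ≠ ∞) :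
    γ (exitTime γ A).toNNReal ∉ A := by
  intro hmem
  set T := (exitTime γ A).toNNReal with hT
  have hT' : (T : ℝ≥0∞) = exitTime γ A := ENNReal.coe_toNNReal hfin
  have hev : ∀ᶠ s in 𝓝[≥] T, γ s ∈ A := (hγ T).eventually (hA.mem_nhds hmem)
  obtain ⟨T', hTT', hsub⟩ := (mem_nhdsGE_iff_exists_Ico_subset' (lt_add_one T)).1 hev
  have : (T' : ℝ≥0∞) ≤ exitTime γ A := by
    refine le_iInf₂ fun t ht => ?_
    rw [ENNReal.coe_le_coe]
    by_contra! hlt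
    have hTt : T ≤ t := by
      rw [← ENNReal.coe_le_coe, hT']
      exact iInf₂_le t ht
    exact ht.2 (hsub ⟨hTt, hlt⟩)
  rw [← hT', ENNReal.coe_le_coe] at this
  exact this.not_gt hTT'

theorem apply_exitTime_mem_frontier (hA : IsOpen A) (hγ : Continuous γ) (h0 : γ 0 ∈ A)
    (hfin : exitTime γ A ≠ ∞) : γ (exitTime γ A).toNNReal ∈ frontier A := by
  have hnot := apply_exitTime_notMem hA (fun t => hγ.continuousWithinAt) hfin
  rw [hA.frontier_eq]
  refine ⟨?_, hnot⟩
  set T := (exitTime γ A).toNNReal with hT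
  have hT' : (T : ℝ≥0∞) = exitTime γ A := ENNReal.coe_toNNReal hfin
  have hT0 : 0 < T := by
    rw [pos_iff_ne_zero]
    intro h
    rw [h] at hnot
    exact hnot h0
  have : (𝓝[<] T).NeBot := nhdsLT_neBot_of_exists_lt ⟨0, hT0⟩
  refine mem_closure_of_tendsto (hγ.continuousWithinAt (s := Iio T)).tendsto ?_
  filter_upwards [self_mem_nhdsWithin, mem_nhdsWithin_of_mem_nhds (lt_mem_nhds hT0)] with s hs hs0
  refine mem_of_lt_exitTime hs0 ?_
  rw [← hT', ENNReal.coe_lt_coe]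
  exact hs

end ExitTime

/-- Pathwise bound on the Feynman-Kac integrand of a function vanishing at the exit point. -/
theorem abs_feynmanKac_integrand_le {F : Type*} {γ : ℝ≥0 → F} {D : Set F} {V u : F → ℝ}
    {M m : ℝ} (hm : 0 ≤ m) (hV : ∀ x ∈ D, |V x| ≤ M) (hu : ∀ x ∈ D, |u x| ≤ m)
    (hexit : exitTime γ D ≠ ∞ → u (γ (exitTime γ D).toNNReal) = 0) {t : ℝ≥0} (ht : 0 < t) :
    |Real.exp (∫ s in (0 : ℝ)..(stoppedTime γ D t : ℝ), V (γ s.toNNReal))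
        * u (γ (stoppedTime γ D t))|
      ≤ (γ ⁻¹' D).indicator (fun _ => Real.exp (M * t) * m) t := by
  have hpos : 0 ≤ (γ ⁻¹' D).indicator (fun _ => Real.exp (M * t) * m) t :=
    indicator_nonneg (fun _ _ => by positivity) _
  rcases le_or_gt (exitTime γ D) t with h | h
  · have hfin : exitTime γ D ≠ ∞ := ne_top_of_le_ne_top ENNReal.coe_ne_top h
    have : stoppedTime γ D t = (exitTime γ D).toNNReal := by
      rw [stoppedTime, min_eq_right h]
    rwa [this, hexit hfin, mul_zero, abs_zero]
  · have hst : stoppedTime γ D t = t := by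
      rw [stoppedTime, min_eq_left h.le, ENNReal.toNNReal_coe]
    have htD : t ∈ γ ⁻¹' D := mem_of_lt_exitTime ht h
    rw [hst, indicator_of_mem htD, abs_mul, Real.abs_exp]
    have hint : ‖∫ s in (0 : ℝ)..(t : ℝ), V (γ s.toNNReal)‖ ≤ M * |(t : ℝ) - 0| := by
      -- The bound needs no integrability of `V` along the path, and only times in `(0, t]`, where
      -- the path is in `D`.
      refine intervalIntegral.norm_integral_le_of_norm_le_const fun s hs => ?_
      rw [uIoc_of_le t.coe_nonneg] at hs
      refine hV _ (mem_of_lt_exitTime (Real.toNNReal_pos.2 hs.1) (lt_of_le_of_lt ?_ h))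
      rw [ENNReal.coe_le_coe]
      exact Real.toNNReal_le_iff_le_coe.2 hs.2
    rw [sub_zero, abs_of_nonneg t.coe_nonneg] at hint
    exact mul_le_mul (Real.exp_le_exp.2 ((le_abs_self _).trans hint)) (hu _ htD) (abs_nonneg _)
      (Real.exp_nonneg _)

/-! ### Estimates for the stable process. -/

variable {d : ℕ} {Ω : Type*} [MeasurableSpace Ω] {P : Measure Ω} {α : ℝ}
  {X : ℝ≥0 → Ω → EuclideanSpace ℝ (Fin d)} {D : Set (EuclideanSpace ℝ (Fin d))}
  {V : EuclideanSpace ℝ (Fin d) → ℝ}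
  {u : BoundedContinuousFunction (EuclideanSpace ℝ (Fin d)) ℝ}

/-- For `α < 2` a jump may land anywhere in `Dᶜ`, where `u` vanishes. For `α = 2` it vanishes only
on the frontier, which a continuous path must hit on exit. -/
theorem IsSolution.apply_exitTime_eq_zero (hX : IsStableProcess P α X) (hD : IsOpen D)
    (hu : IsSolution α D V u) {x₀ : EuclideanSpace ℝ (Fin d)} (hx₀ : x₀ ∈ D) :
    ∀ᵐ ω ∂P, exitTime (fun r => x₀ + X r ω) D ≠ ∞ →
      u (x₀ + X (exitTime (fun r => x₀ + X r ω) D).toNNReal ω) = 0 := by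
  have hcont : ∀ᵐ ω ∂P, α = 2 → Continuous (fun s => X s ω) := by
    by_cases h : α = 2
    · filter_upwards [hX.continuous h] with ω hω _ using hω
    · exact ae_of_all _ fun ω h' => absurd h' h
  filter_upwards [hX.start, hX.cadlag, hcont] with ω h0 hc hc2 hfin
  refine hu.boundary _ ?_
  split_ifs with h
  · exact apply_exitTime_mem_frontier (γ := fun r => x₀ + X r ω) hD
      (continuous_const.add (hc2 h)) (by simpa [h0] using hx₀) hfin
  · exact apply_exitTime_notMem (γ := fun r => x₀ + X r ω) hD
      (fun t => continuousWithinAt_const.add (hc t).1) hfin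

theorem one_le_exp_mul_of_isMaxOn [IsProbabilityMeasure P] (hX : IsStableProcess P α X)
    (hD : IsOpen D) (hu : IsSolution α D V u) (hFK : HasFeynmanKac P X D V u)
    (hne : ∃ x ∈ D, u x ≠ 0) {x₀ : EuclideanSpace ℝ (Fin d)} (hx₀ : x₀ ∈ D)
    (hmax : IsMaxOn (fun x => |u x|) D x₀) {M : ℝ} (hV : ∀ x ∈ D, |V x| ≤ M)
    {t : ℝ≥0} (ht : 0 < t) :
    1 ≤ Real.exp (M * t) * P.real {ω | x₀ + X t ω ∈ D} := by
  obtain ⟨x, hx, hux⟩ := hne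
  have hm : 0 < |u x₀| := (abs_pos.2 hux).trans_le (hmax hx)
  have hmeas : MeasurableSet {ω | x₀ + X t ω ∈ D} :=
    ((hX.measurable t).const_add x₀) hD.measurableSet
  have hle : |u x₀| ≤ ∫ ω, {ω | x₀ + X t ω ∈ D}.indicator
      (fun _ => Real.exp (M * t) * |u x₀|) ω ∂P := by
    conv_lhs => rw [hFK x₀ hx₀ t ht, ← Real.norm_eq_abs]
    refine norm_integral_le_of_norm_le
      ((integrable_indicator_iff hmeas).2 (integrableOn_const (measure_ne_top P _))) ?_
    filter_upwards [hu.apply_exitTime_eq_zero hX hD hx₀] with ω hω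
    exact abs_feynmanKac_integrand_le (γ := fun r => x₀ + X r ω) hm.le hV (fun y hy => hmax hy)
      hω ht
  rw [integral_indicator_const _ hmeas, smul_eq_mul] at hle
  refine le_of_mul_le_mul_right ?_ hm
  linarith

/-- Lower bound for the probability that the process started at `x₀` is in `A` at time `s ^ α`,
given the bound for the law at time `1`. -/
theorem IsStableProcess.smul_volume_le [IsProbabilityMeasure P]
    (hX : IsStableProcess P α X) {ε κ : ℝ}
    (hκ : ∀ (μ : Measure (EuclideanSpace ℝ (Fin d))) [IsFiniteMeasure μ],
      (∀ ξ, charFun μ ξ = ((Real.exp (-‖ξ‖ ^ α) : ℝ) : ℂ)) →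
      ∀ A ⊆ Metric.ball (0 : EuclideanSpace ℝ (Fin d)) ε, ENNReal.ofReal κ * volume A ≤ μ A)
    {s t : ℝ≥0} (hs : 0 < s) (ht : (t : ℝ) = (s : ℝ) ^ α) (x₀ : EuclideanSpace ℝ (Fin d))
    {A : Set (EuclideanSpace ℝ (Fin d))} (hA : MeasurableSet A)
    (hAb : A ⊆ Metric.ball x₀ (s * ε)) :
    ENNReal.ofReal κ * (ENNReal.ofReal ((s : ℝ) ^ d)⁻¹ * volume A)
      ≤ P {ω | x₀ + X t ω ∈ A} := by
  have hs' : (0 : ℝ) < s := hs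
  set Y : Ω → EuclideanSpace ℝ (Fin d) := fun ω => X (0 + t) ω - X 0 ω with hY
  have hYm : Measurable Y := (hX.measurable _).sub (hX.measurable _)
  -- Self-similarity: the increment over time `s ^ α`, divided by `s`, has the standard law.
  set ρ := P.map (fun ω => (s : ℝ)⁻¹ • Y ω) with hρ
  have hρm : Measurable fun ω => (s : ℝ)⁻¹ • Y ω := hYm.const_smul (s : ℝ)⁻¹
  have : IsProbabilityMeasure ρ := Measure.isProbabilityMeasure_map hρm.aemeasurable
  have hchar : ∀ ξ, charFun ρ ξ = ((Real.exp (-‖ξ‖ ^ α) : ℝ) : ℂ) := by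
    intro ξ
    rw [hρ, charFun_map_smul_comp hYm.aemeasurable, hX.charFun_increment, ht, norm_smul,
      Real.norm_of_nonneg (inv_nonneg.2 hs'.le),
      Real.mul_rpow (inv_nonneg.2 hs'.le) (norm_nonneg _), Real.inv_rpow hs'.le, neg_mul,
      mul_inv_cancel_left₀ (Real.rpow_pos_of_pos hs' _).ne']
  set B : Set (EuclideanSpace ℝ (Fin d)) := (fun w => (s : ℝ) • w) ⁻¹' ((fun w => x₀ + w) ⁻¹' A)
    with hB
  have hBm : MeasurableSet B :=
    (measurable_const_smul (s : ℝ)) ((measurable_const_add x₀) hA)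
  have hBb : B ⊆ Metric.ball 0 ε := by
    intro w hw
    have h := hAb hw
    rw [mem_ball_iff_norm, add_sub_cancel_left, norm_smul, Real.norm_of_nonneg hs'.le] at h
    rw [mem_ball_zero_iff]
    exact lt_of_mul_lt_mul_left h hs'.le
  have hvol : volume B = ENNReal.ofReal ((s : ℝ) ^ d)⁻¹ * volume A := by
    rw [hB, Measure.addHaar_preimage_smul _ hs'.ne', measure_preimage_add,
      finrank_euclideanSpace_fin, abs_of_pos (by positivity)]
  have hρB : ρ B = P {ω | x₀ + X t ω ∈ A} := by
    rw [hρ, Measure.map_apply hρm hBm]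
    refine measure_congr ?_
    filter_upwards [hX.start] with ω h0
    refine propext ?_
    change x₀ + (s : ℝ) • (s : ℝ)⁻¹ • (X (0 + t) ω - X 0 ω) ∈ A ↔ x₀ + X t ω ∈ A
    rw [smul_inv_smul₀ hs'.ne', h0, sub_zero, zero_add]
  rw [← hvol, ← hρB]
  exact hκ ρ hchar B hBb

end FracSchrodinger

/-! ### The distance estimate. -/

theorem theorem1p1 (d : ℕ) (hd : 2 ≤ d) (α : ℝ) (hα0 : 0 < α) (hα2 : α ≤ 2)
    (β : ℝ) (hβ0 : 0 < β) (hβ1 : β < 1) :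
    ∃ c : ℝ, 0 < c ∧
      ∀ (Ω : Type*) [MeasurableSpace Ω] (P : Measure Ω) [IsProbabilityMeasure P]
        (X : ℝ≥0 → Ω → EuclideanSpace ℝ (Fin d)), FracSchrodinger.IsStableProcess P α X →
      ∀ D : Set (EuclideanSpace ℝ (Fin d)), FracSchrodinger.IsThickDomain β D →
      ∀ V : EuclideanSpace ℝ (Fin d) → ℝ, AEMeasurable V (volume.restrict D) →
        (∃ M : ℝ, ∀ x ∈ D, |V x| ≤ M) →
      ∀ u : BoundedContinuousFunction (EuclideanSpace ℝ (Fin d)) ℝ,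
        FracSchrodinger.IsSolution α D V u → FracSchrodinger.HasFeynmanKac P X D V u →
        (∃ x ∈ D, u x ≠ 0) →
      ∀ x₀ ∈ D, IsMaxOn (fun x => |u x|) D x₀ →
        ENNReal.ofReal c * (⨆ x ∈ D, ENNReal.ofReal |V x|) ^ (-(1 / α))
          ≤ Metric.infEDist x₀ (frontier D) := by
  have : Nonempty (Fin d) := ⟨⟨0, by omega⟩⟩
  obtain ⟨ε, hε, κ, hκ, hstable⟩ :=
    exists_smul_volume_le_stable (E := EuclideanSpace ℝ (Fin d)) hα0
  set v : ℝ := volume.real (Metric.ball (0 : EuclideanSpace ℝ (Fin d)) 1) with hv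
  have hv0 : 0 < v :=
    ENNReal.toReal_pos (Metric.measure_ball_pos _ _ one_pos).ne' measure_ball_lt_top.ne
  set η : ℝ := κ * (β * ((ε / 3) ^ d * v)) with hη
  have hη0 : 0 < η := by positivity
  refine ⟨η ^ (1 / α) * (ε / 3), by positivity, ?_⟩
  intro Ω _ P _ X hX D hD V _ hVb u hu hFK hne x₀ hx₀ hmax
  rcases (frontier D).eq_empty_or_nonempty with hemp | hfr
  · simp [hemp]
  obtain ⟨z, hz, hzdist⟩ := isClosed_frontier.exists_infDist_eq_dist hfr x₀
  set r := dist x₀ z with hr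
  have hr0 : 0 < r := by
    refine dist_pos.2 ?_
    rintro rfl
    rw [hD.isOpen.frontier_eq] at hz
    exact hz.2 hx₀
  have hedist : Metric.infEDist x₀ (frontier D) = ENNReal.ofReal r := by
    rw [← hzdist, Metric.infDist, ENNReal.ofReal_toReal (Metric.infEDist_ne_top hfr)]
  rw [hedist]
  obtain ⟨M₀, hM₀⟩ := hVb
  set S := ⨆ x ∈ D, ENNReal.ofReal |V x| with hS
  have hSfin : S ≠ ∞ := ne_top_of_le_ne_top ENNReal.ofReal_ne_top
    (iSup₂_le fun x hx => ENNReal.ofReal_le_ofReal (hM₀ x hx))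
  set M := S.toReal with hM
  have hV : ∀ x ∈ D, |V x| ≤ M := fun x hx =>
    (ENNReal.ofReal_le_iff_le_toReal hSfin).1
      (le_iSup₂ (f := fun x (_ : x ∈ D) => ENNReal.ofReal |V x|) x hx)
  -- Chosen so that `s * ε = 3 * r`: the ball `B_r(z)` then lies in `B_{sε}(x₀)`. In `η`, the factor
  -- `(ε / 3) ^ d` is `s⁻ᵈ rᵈ`.
  set s : ℝ≥0 := ⟨3 * r / ε, by positivity⟩ with hs
  have hsr : (s : ℝ) = 3 * r / ε := rfl
  have hs0 : 0 < (s : ℝ) := by rw [hsr]; positivity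
  set t : ℝ≥0 := ⟨(s : ℝ) ^ α, by positivity⟩ with ht
  have htr : (t : ℝ) = (s : ℝ) ^ α := rfl
  have ht0 : 0 < t := by rw [← NNReal.coe_pos, htr]; positivity
  have hexit : η ≤ P.real {ω | x₀ + X t ω ∈ Dᶜ} := by
    have hlow := hX.smul_volume_le hstable hs0 htr x₀
      (A := Dᶜ ∩ Metric.ball z r) (hD.isOpen.measurableSet.compl.inter measurableSet_ball) (by
        intro y hy
        have h1 : dist y z < r := hy.2
        have h2 : (s : ℝ) * ε = 3 * r := by rw [hsr]; field_simp
        rw [Metric.mem_ball, h2]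
        have := dist_triangle_right y x₀ z
        linarith)
    have hthick := hD.thick z hz r hr0
    rw [Measure.addHaar_ball _ _ hr0.le, finrank_euclideanSpace_fin,
      ← ofReal_measureReal (measure_ball_lt_top.ne)] at hthick
    have hmono : P {ω | x₀ + X t ω ∈ Dᶜ ∩ Metric.ball z r} ≤ P {ω | x₀ + X t ω ∈ Dᶜ} :=
      measure_mono fun ω hω => hω.1
    have hη' : ENNReal.ofReal η ≤ P {ω | x₀ + X t ω ∈ Dᶜ} := by
      refine le_trans ?_ (hlow.trans hmono)
      refine le_trans (le_of_eq ?_)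
        (mul_le_mul_right (mul_le_mul_right hthick _) _)
      rw [← ENNReal.ofReal_mul (by positivity), ← ENNReal.ofReal_mul (by positivity),
        ← ENNReal.ofReal_mul (by positivity), ← ENNReal.ofReal_mul (by positivity)]
      congr 1
      rw [hη, hsr, ← hv]
      field_simp
      rw [← mul_pow]
      congr 1
      field_simp
    exact (ENNReal.ofReal_le_iff_le_toReal (measure_ne_top _ _)).1 hη'
  have hstay := FracSchrodinger.one_le_exp_mul_of_isMaxOn hX hD.isOpen hu hFK hne hx₀ hmax hV ht0
  have hmeas : MeasurableSet {ω | x₀ + X t ω ∈ D} :=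
    ((hX.measurable t).const_add x₀) hD.isOpen.measurableSet
  have hcompl : P.real {ω | x₀ + X t ω ∈ Dᶜ} = 1 - P.real {ω | x₀ + X t ω ∈ D} :=
    probReal_compl_eq_one_sub hmeas
  have hηM : η ≤ M * t := by
    have h1 : P.real {ω | x₀ + X t ω ∈ D} ≤ Real.exp (-η) := by
      have := Real.one_sub_le_exp_neg η
      linarith
    have h2 : 1 ≤ Real.exp (M * t - η) := by
      rw [sub_eq_add_neg, Real.exp_add]
      exact hstay.trans (mul_le_mul_of_nonneg_left h1 (Real.exp_nonneg _))
    have := Real.one_le_exp_iff.1 h2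
    linarith
  -- Thus `V = 0` on `D` is impossible once the frontier is nonempty, and the power `0 ^ (-(1 / α))
  -- = ∞` does not arise here.
  have hM0 : 0 < M := pos_of_mul_pos_left (hη0.trans_le hηM) t.coe_nonneg
  rw [← ENNReal.ofReal_toReal hSfin, ENNReal.ofReal_rpow_of_pos hM0,
    ← ENNReal.ofReal_mul (by positivity)]
  refine ENNReal.ofReal_le_ofReal ?_
  have hroot : η ^ (1 / α) ≤ M ^ (1 / α) * (3 * r / ε) := by
    have := Real.rpow_le_rpow hη0.le hηM (one_div_nonneg.2 hα0.le)
    rwa [Real.mul_rpow hM0.le t.coe_nonneg, htr, ← Real.rpow_mul hs0.le,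
      mul_one_div_cancel hα0.ne', Real.rpow_one, hsr] at this
  rw [Real.rpow_neg hM0.le]
  have hMp : 0 < M ^ (1 / α) := Real.rpow_pos_of_pos hM0 _
  calc η ^ (1 / α) * (ε / 3) * (M ^ (1 / α))⁻¹
      ≤ M ^ (1 / α) * (3 * r / ε) * (ε / 3) * (M ^ (1 / α))⁻¹ := by gcongr
    _ = r := by field_simp
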